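/- Let $\square$ be a category of cubes: a category with finite products and an object $I$ with two global points $0,1 : 1 \to I$, such that every object is a finite power of $I$. A cubical set is a presheaf of sets on $\square$. Let $\Delta : \mathbf{Set} \to \widehat{\square}$ be the constant presheaf functor and $\Gamma : \widehat{\square} \to \mathbf{Set}$, $\Gamma X = X(1)$, the global points functor, so $\Gamma\Delta Z \cong Z$. Fix a class of cofibrations $\varphi \hookrightarrow \mathbf{y}n$ into representables and a class of maps $r : n \to I$ in $\square$, both stable under reindexing along maps $m \to n$, such that $\emptyset \hookrightarrow \mathbf{y}n$ is always a cofibration and every global point $1 \to I$ belongs to the second class. A fibration (Kan fibration) is a map $f : X \to Y$ of cubical sets together with a choice of diagonal fillers, uniform in $n$, for all lifting problems of the open box inclusions $$(\varphi \times \mathbf{y}I) \cup \operatorname{graph}(r) \hookrightarrow \mathbf{y}n \times \mathbf{y}I$$ against $f$. A map $f : X \to Y$ is an h-proposition if the endpoint map $\operatorname{Path}_Y(X) \to X \times_Y X$ has a section, where $\operatorname{Path}_Y(X)$ is the pullback of $X^{\mathbf{y}I} \to Y^{\mathbf{y}I}$ along the constant path map $Y \to Y^{\mathbf{y}I}$.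 A propositional truncation of $f : X \to Y$ is a fibration $\|X\|_Y \to Y$ that is an h-proposition, with a map $X \to \|X\|_Y$ over $Y$, such that whenever $Q \to Y$ is a fibration and an h-proposition and there is a map $X \to Q$ over $Y$, there is a map $\|X\|_Y \to Q$ over $Y$. 1. Let $f : W \to \Delta Z$ be a fibration, where $Z$ is a set, and let $\|W\|_{\Delta Z} \to \Delta Z$ be a propositional truncation of $f$. If $\|W\|_{\Delta Z} \to \Delta Z$ has a section, then so does the map $\Gamma W \to \Gamma\Delta Z \cong Z$. 2. More generally, let $f : X \to Y$ be a fibration of cubical sets, and let $\|X\|_Y \to Y$ be a propositional truncation of $f$. If $\|X\|_Y \to Y$ has a section, then so does the map $\Gamma f : \Gamma X \to \Gamma Y$. -/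

import Mathlib

open CategoryTheory MonoidalCategory CartesianMonoidalCategory Opposite Limits

universe w v u

namespace CubicalSets

/-- A category of cubes: a category with (chosen) finite products and an object `interval`,
with two global points, such that every object is a finite power of `interval`. -/
class CubeCategory (C : Type u) [Category.{v} C] [CartesianMonoidalCategory C] where
  /-- the interval object `[1]` -/
  interval : C
  /-- the first endpoint of the interval -/
  zero : 𝟙_ C ⟶ interval
  /-- the second endpoint of the interval -/
  one : 𝟙_ C ⟶ interval
  /-- every object is an `n`-fold product of the interval -/
  exists_iso_power : ∀ c : C, ∃ n : ℕ,
    Nonempty (c ≅ Nat.rec (motive := fun _ => C) (𝟙_ C) (fun _ d => d ⊗ interval) n)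

/-- Cubical sets: presheaves on the category of cubes. -/
abbrev CSet (C : Type u) [Category.{v} C] : Type (max u v (w + 1)) := Cᵒᵖ ⥤ Type w

/-- The constant (discrete) cubical set functor `Δ`. -/
abbrev disc (C : Type u) [Category.{v} C] : Type w ⥤ CSet.{w} C := Functor.const Cᵒᵖ

/-- The global points functor `Γ`, which evaluates a cubical set at the terminal object `[0]`. -/
abbrev points (C : Type u) [Category.{v} C] [CartesianMonoidalCategory C] :
    CSet.{w} C ⥤ Type w :=
  (evaluation Cᵒᵖ (Type w)).obj (op (𝟙_ C))

/-- The canonical isomorphism `Γ Δ Z ≅ Z`. -/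
def pointsDiscIso (C : Type u) [Category.{v} C] [CartesianMonoidalCategory C] (Z : Type w) :
    (points.{w} C).obj ((disc.{w} C).obj Z) ≅ Z :=
  Iso.refl Z

section Cubes

variable {C : Type u} [Category.{v} C] [CartesianMonoidalCategory C] [CubeCategory C]

open CubeCategory (interval)

/-! ### Kan fibrations -/

/-- The data that fix which open boxes have to be filled: a class of cofibrations
`φ ↪ y n` into representables (a sieve on `n` is the same as a subpresheaf of `y n`) and a class
of generalised points `r : y n → y I` from which one fills; both are stable under reindexing,
`∅ ↪ y n` is a cofibration, and one can fill from every global point of the interval.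
Examples: `r` constant at an endpoint and `φ` in the face lattice (the cubical type theory of
Cohen, Coquand, Huber and Mörtberg); all `r` and a class of `φ` that contains the diagonals
(Cartesian cubical sets). -/
structure BoxSystem (C : Type u) [Category.{v} C] [CartesianMonoidalCategory C]
    [CubeCategory C] where
  cof : ∀ n : C, Set (Sieve n)
  cof_pullback : ∀ {m n : C} (s : m ⟶ n) {φ : Sieve n}, φ ∈ cof n → φ.pullback s ∈ cof m
  bot_mem_cof : ∀ n : C, (⊥ : Sieve n) ∈ cof n
  dir : ∀ n : C, Set (n ⟶ interval (C := C))
  dir_comp : ∀ {m n : C} (s : m ⟶ n) {r : n ⟶ interval}, r ∈ dir n → s ≫ r ∈ dir m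
  point_mem_dir : ∀ d : 𝟙_ C ⟶ interval, d ∈ dir (𝟙_ C)

/-- The open box `(φ × I) ∪ graph r` inside `y (n × I) = y n × y I`. -/
def openBox {n : C} (φ : Sieve n) (r : n ⟶ interval) : Sieve (n ⊗ interval) where
  arrows _ g := φ.arrows (g ≫ fst n interval) ∨ g ≫ snd n interval = g ≫ fst n interval ≫ r
  downward_closed := by
    rintro m m' g (hg | hg) h
    · left
      simpa using φ.downward_closed hg h
    · right
      simp [hg]

/-- Reindexing an open box along `s : m ⟶ n`. -/
theorem openBox_reindex {m n : C} (s : m ⟶ n) {φ : Sieve n} {r : n ⟶ interval} {k : C}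
    {g : k ⟶ m ⊗ interval} (hg : (openBox (φ.pullback s) (s ≫ r)).arrows g) :
    (openBox φ r).arrows (g ≫ s ▷ interval) := by
  rcases hg with hg | hg
  · left
    simpa [Sieve.pullback] using hg
  · right
    simpa using hg

variable (K : BoxSystem C)

/-- A lifting problem of an open box inclusion against `f`: a commutative square with top map
`x : openBox φ r → X` and bottom map `y : y (n × I) → Y`. By the Yoneda lemma, these are given as
a compatible family of elements of `X` and as an element of `Y` at `n × I`. -/
structure BoxProblem {X Y : CSet.{w} C} (f : X ⟶ Y) where
  n : C
  φ : Sieve n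
  φ_mem : φ ∈ K.cof n
  r : n ⟶ interval (C := C)
  r_mem : r ∈ K.dir n
  x : Presieve.FamilyOfElements X (openBox φ r).arrows
  x_compat : x.SieveCompatible
  y : Y.obj (op (n ⊗ interval))
  comm : ∀ ⦃k : C⦄ (g : k ⟶ n ⊗ interval) (hg : (openBox φ r).arrows g),
    f.app (op k) (x g hg) = Y.map g.op y

/-- Restriction of a lifting problem along a map `s : m ⟶ n` of cubes. -/
def BoxProblem.reindex {X Y : CSet.{w} C} {f : X ⟶ Y} (B : BoxProblem K f) {m : C}
    (s : m ⟶ B.n) : BoxProblem K f where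
  n := m
  φ := B.φ.pullback s
  φ_mem := K.cof_pullback s B.φ_mem
  r := s ≫ B.r
  r_mem := K.dir_comp s B.r_mem
  x _ g hg := B.x (g ≫ s ▷ interval) (openBox_reindex s hg)
  x_compat := by
    intro k k' g h hg
    have := B.x_compat (g ≫ s ▷ interval) h (openBox_reindex s hg)
    simpa only [Category.assoc] using this
  y := Y.map (s ▷ interval).op B.y
  comm := by
    intro k g hg
    have := B.comm (g ≫ s ▷ interval) (openBox_reindex s hg)
    simpa using this

/-- A Kan fibration structure on `f`: a choice of a diagonal filler for every lifting problem of
an open box against `f`, uniform in the sense that it commutes with reindexing. -/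
structure KanFibration {X Y : CSet.{w} C} (f : X ⟶ Y) where
  fill : ∀ B : BoxProblem K f, X.obj (op (B.n ⊗ interval))
  fill_extends : ∀ (B : BoxProblem K f), B.x.IsAmalgamation (fill B)
  fill_over : ∀ B : BoxProblem K f, f.app _ (fill B) = B.y
  uniform : ∀ (B : BoxProblem K f) {m : C} (s : m ⟶ B.n),
    fill (B.reindex K s) = X.map (s ▷ interval).op (fill B)

/-! ### Paths and homotopy propositions -/

/-- The path object functor `X ↦ X ^ I`. Since `I` is representable, `(X ^ I) n = X (n × I)`. -/
abbrev pathObj : CSet.{w} C ⥤ CSet.{w} C :=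
  (Functor.whiskeringLeft _ _ (Type w)).obj (tensorRight (interval (C := C))).op

/-- The constant path map `X → X ^ I`. -/
def constPath (X : CSet.{w} C) : X ⟶ pathObj.obj X where
  app n := X.map (fst n.unop interval).op
  naturality := by
    intro m n s
    dsimp
    rw [← X.map_comp, ← X.map_comp]
    congr 1
    apply Quiver.Hom.unop_inj
    simp

/-- Evaluation `X ^ I → X` of paths at a global point `d` of the interval. -/
def evalPath (d : 𝟙_ C ⟶ interval (C := C)) (X : CSet.{w} C) : pathObj.obj X ⟶ X where
  app n := X.map (lift (𝟙 n.unop) (toUnit n.unop ≫ d)).op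
  naturality := by
    intro m n s
    dsimp
    rw [← X.map_comp, ← X.map_comp]
    congr 1
    apply Quiver.Hom.unop_inj
    apply CartesianMonoidalCategory.hom_ext <;> simp

theorem constPath_naturality {X Y : CSet.{w} C} (f : X ⟶ Y) :
    f ≫ constPath Y = constPath X ≫ pathObj.map f := by
  ext n x
  simp [constPath]

theorem evalPath_naturality (d : 𝟙_ C ⟶ interval (C := C)) {X Y : CSet.{w} C} (f : X ⟶ Y) :
    pathObj.map f ≫ evalPath d Y = evalPath d X ≫ f := by
  ext n x
  simp [evalPath]

theorem constPath_evalPath (d : 𝟙_ C ⟶ interval (C := C)) (X : CSet.{w} C) :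
    constPath X ≫ evalPath d X = 𝟙 X := by
  ext n x
  dsimp [constPath, evalPath]
  rw [← ConcreteCategory.comp_apply, ← X.map_comp, ← op_comp]
  simp

/-- `Path_Y(X)`, the pullback of `X ^ I → Y ^ I` along the constant path map `Y → Y ^ I`. -/
noncomputable abbrev PathOver {X Y : CSet.{w} C} (f : X ⟶ Y) : CSet.{w} C :=
  pullback (pathObj.map f) (constPath Y)

/-- Evaluation of a path over `Y` at a point. -/
noncomputable def PathOver.eval (d : 𝟙_ C ⟶ interval (C := C)) {X Y : CSet.{w} C} (f : X ⟶ Y) :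
    PathOver f ⟶ X :=
  pullback.fst (pathObj.map f) (constPath Y) ≫ evalPath d X

theorem PathOver.eval_comp (d : 𝟙_ C ⟶ interval (C := C)) {X Y : CSet.{w} C} (f : X ⟶ Y) :
    PathOver.eval d f ≫ f = pullback.snd (pathObj.map f) (constPath Y) := by
  rw [PathOver.eval, Category.assoc, ← evalPath_naturality, pullback.condition_assoc,
    constPath_evalPath, Category.comp_id]

/-- The endpoint map `Path_Y(X) → X ×_Y X`. -/
noncomputable def pathEndpoints {X Y : CSet.{w} C} (f : X ⟶ Y) : PathOver f ⟶ pullback f f :=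
  pullback.lift (PathOver.eval CubeCategory.zero f) (PathOver.eval CubeCategory.one f)
    (by rw [PathOver.eval_comp, PathOver.eval_comp])

/-- `f : X ⟶ Y` is a homotopy proposition: `Path_Y(X) → X ×_Y X` has a section. -/
def IsHProp {X Y : CSet.{w} C} (f : X ⟶ Y) : Prop := IsSplitEpi (pathEndpoints f)

/-! ### Propositional truncation -/

/-- A propositional truncation of `f : X ⟶ Y` over `Y`: a Kan fibration `proj : obj ⟶ Y` that is
an h-proposition, with a map `X ⟶ obj` over `Y`, and such that every map over `Y` from `X` to an
h-proposition (which is a Kan fibration) `q : Q ⟶ Y` gives a map `obj ⟶ Q` over `Y`. (Such a map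
automatically extends the given one up to homotopy over `Y`, since `q` is an h-proposition.) -/
structure PropTrunc {X Y : CSet.{w} C} (f : X ⟶ Y) where
  obj : CSet.{w} C
  proj : obj ⟶ Y
  kan : KanFibration K proj
  isHProp : IsHProp proj
  unit : X ⟶ obj
  unit_proj : unit ≫ proj = f
  recursion : ∀ {Q : CSet.{w} C} (q : Q ⟶ Y), KanFibration K q → IsHProp q →
    ∀ g : X ⟶ Q, g ≫ q = f → ∃ h : obj ⟶ Q, h ≫ q = proj

end Cubes

end CubicalSets

/-!
Let `P` be the image of `Γ f`, and let `A` be the largest subpresheaf of `Y` whose global points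
lie in `P`: it consists of the cubes all of whose vertices lie in `P`. Filling open boxes in `X`
shows that `P` is closed under paths in `Y`. Any vertex `(q, e)` of a cube over `n × I` is joined
by an edge to the vertex `(q, r q)` on the graph of `r`, so `A ⟶ Y` is a Kan fibration; being a
monomorphism, it is also an h-proposition. Since `f` factors through `A`, a section of the
truncation gives a section of `A ⟶ Y`, so that `A = Y` and `Γ f` is surjective.
-/

namespace CubicalSets

section VerticesIn

variable {C : Type u} [Category.{v} C] [CartesianMonoidalCategory C] {Y : CSet.{w} C}

/-- The cubes of `Y` all of whose vertices lie in `P`. By `le_verticesIn_iff` this is the largest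
subpresheaf of `Y` with global points in `P`. -/
def verticesIn (P : Set ((points.{w} C).obj Y)) : Subfunctor Y where
  obj n := {y | ∀ p : 𝟙_ C ⟶ n.unop, Y.map p.op y ∈ P}
  map s y hy p := by simpa using hy (p ≫ s.unop)

theorem le_verticesIn_iff {A : Subfunctor Y} {P : Set ((points.{w} C).obj Y)} :
    A ≤ verticesIn P ↔ A.obj (op (𝟙_ C)) ⊆ P := by
  constructor
  · intro hA y hy
    simpa using hA _ hy (𝟙 (𝟙_ C))
  · intro hA n y hy p
    exact hA (A.map p.op hy)

end VerticesIn

section Fibrations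

variable {C : Type u} [Category.{v} C] [CartesianMonoidalCategory C] [CubeCategory C]
  {X Y : CSet.{w} C}

open CubeCategory (interval)

/-- The map `X ⟶ Path_Y(X)` that sends a cube of `X` to the constant path at it. -/
noncomputable def constPathOver (f : X ⟶ Y) : X ⟶ PathOver f :=
  pullback.lift (constPath X) f (constPath_naturality f).symm

theorem constPathOver_eval (f : X ⟶ Y) (d : 𝟙_ C ⟶ interval (C := C)) :
    constPathOver f ≫ PathOver.eval d f = 𝟙 X := by
  rw [constPathOver, PathOver.eval, pullback.lift_fst_assoc, constPath_evalPath]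

theorem constPathOver_pathEndpoints (f : X ⟶ Y) :
    constPathOver f ≫ pathEndpoints f = pullback.diagonal f := by
  apply pullback.hom_ext
  · rw [Category.assoc, pathEndpoints, pullback.lift_fst, constPathOver_eval,
      pullback.diagonal_fst]
  · rw [Category.assoc, pathEndpoints, pullback.lift_snd, constPathOver_eval,
      pullback.diagonal_snd]

theorem isHProp_of_mono (f : X ⟶ Y) [Mono f] : IsHProp f :=
  .mk' ⟨inv (pullback.diagonal f) ≫ constPathOver f, by
    rw [Category.assoc, constPathOver_pathEndpoints, IsIso.inv_hom_id]⟩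

variable {K : BoxSystem C}

theorem BoxProblem.map_y_mem {A : Subfunctor Y} (B : BoxProblem K A.ι) {k : C}
    {g : k ⟶ B.n ⊗ interval} (hg : (openBox B.φ B.r).arrows g) :
    Y.map g.op B.y ∈ A.obj (op k) := by
  rw [← B.comm g hg]
  exact (B.x g hg).2

/-- The Kan fibration structure on the inclusion of a subpresheaf that contains the base cube of
each of its lifting problems; there is no choice of fillers, so uniformity is automatic. -/
def KanFibration.ofSubfunctor (A : Subfunctor Y)
    (hA : ∀ B : BoxProblem K A.ι, B.y ∈ A.obj (op (B.n ⊗ interval))) : KanFibration K A.ι where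
  fill B := ⟨B.y, hA B⟩
  fill_extends B _ g hg := Subtype.ext (B.comm g hg).symm
  fill_over _ := rfl
  uniform _ _ _ := rfl

theorem eq_of_mem_openBox_bot {n k : C} {r : n ⟶ interval} {g : k ⟶ n ⊗ interval}
    (hg : (openBox ⊥ r).arrows g) : g = (g ≫ fst n interval) ≫ lift (𝟙 n) r := by
  have graph : g ≫ snd n interval = g ≫ fst n interval ≫ r := hg.resolve_left id
  apply CartesianMonoidalCategory.hom_ext <;> simp [graph]

/-- The lifting problem whose open box is the graph of `r` alone, with `x` lying over it. -/
def BoxProblem.ofGraph {f : X ⟶ Y} {n : C} {r : n ⟶ interval} (hr : r ∈ K.dir n)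
    (y : Y.obj (op (n ⊗ interval))) (x : X.obj (op n))
    (hx : f.app _ x = Y.map (lift (𝟙 n) r).op y) : BoxProblem K f where
  n := n
  φ := ⊥
  φ_mem := K.bot_mem_cof n
  r := r
  r_mem := hr
  x _ g _ := X.map (g ≫ fst n interval).op x
  x_compat _ _ g h _ := by simp
  y := y
  comm k g hg := by
    rw [NatTrans.naturality_apply, hx, ← ConcreteCategory.comp_apply, ← Y.map_comp, ← op_comp,
      ← eq_of_mem_openBox_bot hg]

theorem KanFibration.exists_lift_of_graph {f : X ⟶ Y} (F : KanFibration K f) {n : C}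
    {r : n ⟶ interval} (hr : r ∈ K.dir n) (y : Y.obj (op (n ⊗ interval))) (x : X.obj (op n))
    (hx : f.app _ x = Y.map (lift (𝟙 n) r).op y) :
    ∃ z : X.obj (op (n ⊗ interval)), f.app _ z = y :=
  ⟨F.fill (.ofGraph hr y x hx), F.fill_over (.ofGraph hr y x hx)⟩

/-- A set of global points of `Y` is path-closed if with one point of a path it contains every
point of the path. The points compared are at arbitrary `d` and `e`, not only at endpoints. -/
def IsPathClosed (P : Set ((points.{w} C).obj Y)) : Prop :=
  ∀ (γ : (points.{w} C).obj (pathObj.obj Y)) (d e : 𝟙_ C ⟶ interval (C := C)),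
    (evalPath d Y).app _ γ ∈ P → (evalPath e Y).app _ γ ∈ P

theorem KanFibration.isPathClosed_range_points {f : X ⟶ Y} (F : KanFibration K f) :
    IsPathClosed (Set.range ((points.{w} C).map f)) := by
  rintro γ d e ⟨x, hx⟩
  obtain ⟨z, rfl⟩ := F.exists_lift_of_graph (K.point_mem_dir _) γ x hx
  exact ⟨(evalPath e X).app _ z, NatTrans.naturality_apply f _ z⟩

theorem evalPath_app_map_whiskerRight {n : C} (y : Y.obj (op (n ⊗ interval))) (q : 𝟙_ C ⟶ n)
    (e : 𝟙_ C ⟶ interval (C := C)) :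
    (evalPath e Y).app (op (𝟙_ C)) (Y.map (q ▷ interval).op y) = Y.map (lift q e).op y := by
  dsimp only [evalPath]
  rw [← ConcreteCategory.comp_apply, ← Y.map_comp, ← op_comp]
  simp [toUnit_unique (toUnit (𝟙_ C)) (𝟙 _)]

theorem IsPathClosed.map_lift_mem {P : Set ((points.{w} C).obj Y)} (hP : IsPathClosed P) {n : C}
    (y : Y.obj (op (n ⊗ interval))) (q : 𝟙_ C ⟶ n) {d : 𝟙_ C ⟶ interval (C := C)}
    (hd : Y.map (lift q d).op y ∈ P) (e : 𝟙_ C ⟶ interval) :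
    Y.map (lift q e).op y ∈ P := by
  rw [← evalPath_app_map_whiskerRight] at hd ⊢
  exact hP _ d e hd

theorem IsPathClosed.base_mem_verticesIn {P : Set ((points.{w} C).obj Y)} (hP : IsPathClosed P)
    (B : BoxProblem K (verticesIn P).ι) :
    B.y ∈ (verticesIn P).obj (op (B.n ⊗ interval)) := by
  intro p
  let q : 𝟙_ C ⟶ B.n := p ≫ fst _ _
  have on_graph : (openBox B.φ B.r).arrows (lift q (q ≫ B.r)) := .inr (by simp)
  have graph_mem : Y.map (lift q (q ≫ B.r)).op B.y ∈ P :=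
    le_verticesIn_iff.1 le_rfl (B.map_y_mem on_graph)
  have p_eq : p = lift q (p ≫ snd _ _) := by
    apply CartesianMonoidalCategory.hom_ext <;> simp [q]
  rw [p_eq]
  exact hP.map_lift_mem B.y q graph_mem _

theorem PropTrunc.isSplitEpi_of_factorization {f : X ⟶ Y} (T : PropTrunc K f)
    [IsSplitEpi T.proj] {Q : CSet.{w} C} {q : Q ⟶ Y} (F : KanFibration K q) (hq : IsHProp q)
    (g : X ⟶ Q) (hg : g ≫ q = f) : IsSplitEpi q := by
  obtain ⟨h, hh⟩ := T.recursion q F hq g hg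
  exact .mk' ⟨section_ T.proj ≫ h, by rw [Category.assoc, hh, IsSplitEpi.id]⟩

theorem PropTrunc.subfunctor_eq_top {f : X ⟶ Y} (T : PropTrunc K f) [IsSplitEpi T.proj]
    {A : Subfunctor Y} (F : KanFibration K A.ι) (hA : Subfunctor.range f ≤ A) : A = ⊤ := by
  have : IsSplitEpi A.ι :=
    T.isSplitEpi_of_factorization F (isHProp_of_mono _) (Subfunctor.lift f hA) rfl
  exact A.eq_top_iff_isIso.2 (isIso_of_mono_of_isSplitEpi _)

theorem PropTrunc.surjective_points_map {f : X ⟶ Y} (T : PropTrunc K f) [IsSplitEpi T.proj]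
    (F : KanFibration K f) : Function.Surjective ((points.{w} C).map f) := by
  have verticesIn_eq_top : verticesIn (Set.range ((points.{w} C).map f)) = ⊤ :=
    T.subfunctor_eq_top (.ofSubfunctor _ F.isPathClosed_range_points.base_mem_verticesIn)
      (le_verticesIn_iff.2 subset_rfl)
  intro y
  exact le_verticesIn_iff.1 verticesIn_eq_top.ge (Set.mem_univ y)

end Fibrations

end CubicalSets

theorem mainTheorem8 {C : Type u} [Category.{v} C] [CartesianMonoidalCategory C]
    [CubicalSets.CubeCategory C] (K : CubicalSets.BoxSystem C) :
    (∀ (Z : Type w) (W : CubicalSets.CSet.{w} C) (f : W ⟶ (CubicalSets.disc.{w} C).obj Z)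
        (_ : CubicalSets.KanFibration K f) (T : CubicalSets.PropTrunc K f),
        IsSplitEpi T.proj →
        IsSplitEpi ((CubicalSets.points.{w} C).map f ≫
          (CubicalSets.pointsDiscIso.{w} C Z).hom)) ∧
    (∀ (X Y : CubicalSets.CSet.{w} C) (f : X ⟶ Y)
        (_ : CubicalSets.KanFibration K f) (T : CubicalSets.PropTrunc K f),
        IsSplitEpi T.proj →
        IsSplitEpi ((CubicalSets.points.{w} C).map f)) := by
  have isSplitEpi_points (X Y : CubicalSets.CSet.{w} C) (f : X ⟶ Y)
      (F : CubicalSets.KanFibration K f) (T : CubicalSets.PropTrunc K f) (_ : IsSplitEpi T.proj) :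
      IsSplitEpi ((CubicalSets.points.{w} C).map f) :=
    (isSplitEpi_iff_surjective _).2 (T.surjective_points_map F)
  refine ⟨fun Z W f F T hT ↦ ?_, isSplitEpi_points⟩
  have := isSplitEpi_points _ _ f F T hT
  infer_instance
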